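/- Let $\mathbb H$ be the quaternions and $\mathbb S=\{I\in\mathbb H: I^2=-1\}$. A function $f:\mathbb H\to\mathbb H$ is slice regular if it is real differentiable and, for every $I\in\mathbb S$, the function $(x,y)\mapsto f(x+Iy)$ is $C^1$ on $\mathbb R^2$ and satisfies $\frac12\left(\partial_x+I\,\partial_y\right)f(x+Iy)=0$. For $J\in\mathbb S$ let $\mathcal F^2_{slice}(\mathbb H)$ be the space of all slice regular $f$ with $$\int_{\mathbb R^2}|f(x+Jy)|^2e^{-(x^2+y^2)}\,dx\,dy<\infty .$$ For $\psi\in L^2(\mathbb R;\mathbb H)$ let $$\mathcal B\psi(q)=\pi^{-3/4}\int_{\mathbb R}e^{-\frac12(q^2+x^2)+\sqrt2\,qx}\,\psi(x)\,dx\qquad(q\in\mathbb H),$$ and for $I\in\mathbb S$ and $\psi\in L^1(\mathbb R;\mathbb H)$ let $\mathcal F_I\psi(x)=\int_{\mathbb R}e^{Ixy}\psi(y)\,dy$. Theorem. Let $I,J\in\mathbb S$ be arbitrary. Then $\mathcal B$ is a bijection of $L^2(\mathbb R;\mathbb H)$ onto $\mathcal F^2_{slice}(\mathbb H)$ (defined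 through the slice of $J$; in particular the space does not depend on $J$), so that $\mathcal B^{-1}:\mathcal F^2_{slice}(\mathbb H)\to L^2(\mathbb R;\mathbb H)$ is defined; the restriction of $\mathcal F_I$ to $L^1\cap L^2$ has a unique extension to a bounded real-linear operator on $L^2(\mathbb R;\mathbb H)$, again denoted $\mathcal F_I$; and for every $f\in\mathcal F^2_{slice}(\mathbb H)$ and every $x\in\mathbb R$, $$\mathcal B\,\mathcal F_I\,\mathcal B^{-1}(f)(x)=\sqrt{2\pi}\,f(Ix).$$ -/

import Mathlib

open MeasureTheory
open scoped Quaternion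

noncomputable section

namespace SliceFock

/-- The sphere `𝕊` of imaginary units of the quaternions. -/
def imagUnits : Set ℍ[ℝ] := {I | I ^ 2 = -1}

/-- The point `x + y I` of the slice `ℂ_I = ℝ + ℝ I`. -/
def slicePt (I : ℍ[ℝ]) (x y : ℝ) : ℍ[ℝ] := (x : ℍ[ℝ]) + (y : ℍ[ℝ]) * I

/-- (Left) slice regular functions on the whole of `ℍ`: real differentiable, and for every
imaginary unit `I` the restriction to the slice `ℂ_I` is of class `C¹` in `(x, y)` and is
annihilated by `(1/2) (∂/∂x + I ∂/∂y)`. -/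
structure IsSliceRegular (f : ℍ[ℝ] → ℍ[ℝ]) : Prop where
  differentiable : Differentiable ℝ f
  contDiff_slice : ∀ I ∈ imagUnits, ContDiff ℝ 1 (fun p : ℝ × ℝ => f (slicePt I p.1 p.2))
  dbar_eq_zero : ∀ I ∈ imagUnits, ∀ x y : ℝ,
    (1 / 2 : ℝ) • (deriv (fun s : ℝ => f (slicePt I s y)) x
      + I * deriv (fun t : ℝ => f (slicePt I x t)) y) = 0

/-- The slice hyperholomorphic Bargmann-Fock space `F^{2,ν}_J(ℍ)`: slice regular functions on `ℍ`
whose restriction to the slice `ℂ_J` is square integrable for `e^{-ν |q|²} dx dy`. -/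
def fockSpace (ν : ℝ) (J : ℍ[ℝ]) : Set (ℍ[ℝ] → ℍ[ℝ]) :=
  {f | IsSliceRegular f ∧
    Integrable (fun p : ℝ × ℝ =>
      ‖f (slicePt J p.1 p.2)‖ ^ 2 * Real.exp (-ν * ‖slicePt J p.1 p.2‖ ^ 2)) volume}

/-- The Hilbert space `L²(ℝ; ℍ)`, with Lebesgue measure on `ℝ`. -/
abbrev L2 : Type := Lp ℍ[ℝ] 2 (volume : Measure ℝ)

/-- The kernel `A(q; x) = (ν/π)^{3/4} exp(-(ν/2) (q² + x²) + ν √2 q x)`. -/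
def kernelA (ν : ℝ) (q : ℍ[ℝ]) (x : ℝ) : ℍ[ℝ] :=
  ((ν / Real.pi) ^ (3 / 4 : ℝ) : ℝ) •
    NormedSpace.exp ((-ν / 2 : ℝ) • (q ^ 2 + (x : ℍ[ℝ]) ^ 2)
      + (ν * Real.sqrt 2) • (q * (x : ℍ[ℝ])))

/-- The quaternionic Segal-Bargmann transform `B_ν`, on `L²(ℝ; ℍ)`. -/
def segalBargmann (ν : ℝ) (ψ : L2) (q : ℍ[ℝ]) : ℍ[ℝ] :=
  ∫ x : ℝ, kernelA ν q x * ψ x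

/-- The inverse of `B_ν` (meaningful on the range of `B_ν`, where `B_ν` is injective). -/
def segalBargmannInv (ν : ℝ) : (ℍ[ℝ] → ℍ[ℝ]) → L2 :=
  Function.invFun (segalBargmann ν)

/-- The left one-dimensional quaternionic Fourier integral `∫ e^{I x y} ψ(y) dy`
of an integrable function. -/
def fourierIntegral (I : ℍ[ℝ]) (ψ : ℝ → ℍ[ℝ]) (x : ℝ) : ℍ[ℝ] :=
  ∫ y : ℝ, NormedSpace.exp (I * (x : ℍ[ℝ]) * (y : ℍ[ℝ])) * ψ y

/-- `T` is a bounded (real linear) operator of `L²(ℝ; ℍ)` that is given on `L¹ ∩ L²` by the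
Fourier integral. -/
def IsFourierExtension (I : ℍ[ℝ]) (T : L2 →L[ℝ] L2) : Prop :=
  ∀ ψ : L2, Integrable (ψ : ℝ → ℍ[ℝ]) volume →
    (T ψ : ℝ → ℍ[ℝ]) =ᵐ[volume] fourierIntegral I (ψ : ℝ → ℍ[ℝ])

open Classical in
/-- The Fourier transform `F_I` on `L²(ℝ; ℍ)`: the bounded extension of the Fourier integral
from the dense subspace `L¹ ∩ L²`. -/
def fourierL2 (I : ℍ[ℝ]) : L2 →L[ℝ] L2 :=
  if h : ∃ T : L2 →L[ℝ] L2, IsFourierExtension I T then h.choose else 0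

end SliceFock

end

/-!
Left multiplication by an imaginary unit `I` makes `ℍ` a complex Hilbert space, and the restriction
of `B ψ` to the slice `ℂ_I` is then the classical Bargmann transform of a vector valued function.
Up to a factor of modulus one, `exp (-ν |z|² / 2) B ψ (z)` with `z = x + y i` is a Fourier transform
in `y` of `ψ` multiplied by a Gaussian window centred at `√2 x`, so Plancherel's theorem makes `B`
isometric. Its range is everything: the adjoint, evaluated on coherent states, inverts `B` because a
holomorphic function reproduces itself against the Gaussian by the mean value property.

A slice regular function is holomorphic on every slice, hence determined by its values on the real
line, so that a preimage found on one slice `ℂ_J` is a preimage on `ℍ`. On `ℂ_I` the Fourier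
transform of the Bargmann kernel is `√(2π)` times the kernel at `i z`, which conjugates `F_I` to the
rotation of the variable by `I`.
-/

noncomputable section

namespace SliceFock

section FourierInv

open FourierTransform
open scoped ContDiff

variable {V E : Type*} [NormedAddCommGroup V] [InnerProductSpace ℝ V] [FiniteDimensional ℝ V]
  [MeasurableSpace V] [BorelSpace V] [NormedAddCommGroup E]

theorem continuous_fourierInv [NormedSpace ℂ E] {f : V → E} (hf : Integrable f) :
    Continuous (𝓕⁻ f) := by
  rw [show 𝓕⁻ f = 𝓕 f ∘ Neg.neg from funext fun x => Real.fourierInv_eq_fourier_neg f x]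
  exact (VectorFourier.fourierIntegral_continuous Real.continuous_fourierChar continuous_inner
    hf).comp continuous_neg

theorem fourierInv_eq_fourierIntegral_neg_inner [NormedSpace ℂ E] (f : V → E) :
    𝓕⁻ f = VectorFourier.fourierIntegral Real.fourierChar volume (-innerₗ V) f := by
  ext ξ
  simp [Real.fourierInv_eq, VectorFourier.fourierIntegral]

theorem integral_fourierInv_smul_eq [NormedSpace ℂ E] [CompleteSpace E] {f : V → ℂ} {g : V → E}
    (hf : Integrable f) (hg : Integrable g) :
    ∫ ξ, 𝓕⁻ f ξ • g ξ = ∫ x, f x • 𝓕⁻ g x := by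
  have hself := VectorFourier.integral_fourierIntegral_smul_eq_flip (L := -innerₗ V)
    Real.continuous_fourierChar (continuous_inner (𝕜 := ℝ) (E := V)).neg hf hg
  have hflip : (-innerₗ V).flip = -innerₗ V := by
    ext x y
    simp [real_inner_comm]
  rw [hflip] at hself
  rw [fourierInv_eq_fourierIntegral_neg_inner, fourierInv_eq_fourierIntegral_neg_inner]
  exact hself

variable [InnerProductSpace ℂ E] [CompleteSpace E]

theorem coeFn_fourierInv_ae_eq (f : Lp E 2 (volume : Measure V)) (hf : Integrable f) :
    (𝓕⁻ f : Lp E 2 (volume : Measure V)) =ᵐ[volume] 𝓕⁻ (f : V → E) := by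
  refine ae_eq_of_integral_contDiff_smul_eq ((Lp.memLp _).locallyIntegrable one_le_two)
    (continuous_fourierInv hf).locallyIntegrable fun g g_smooth g_supp => ?_
  let G : SchwartzMap V ℂ := HasCompactSupport.toSchwartzMap (f := Complex.ofRealCLM ∘ g)
    (g_supp.comp_left rfl) (by fun_prop)
  have hdistrib := congrArg (fun T => T G) (Lp.fourierInv_toTemperedDistribution_eq f)
  simp only [TemperedDistribution.fourierInv_apply, Lp.toTemperedDistribution_apply] at hdistrib
  have hG (h : V → E) : ∫ x, g x • h x = ∫ x, G x • h x :=
    integral_congr_ae (.of_forall fun x => (Complex.coe_smul (g x) (h x)).symm)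
  rw [hG, hG, ← hdistrib, SchwartzMap.fourierInv_coe, integral_fourierInv_smul_eq G.integrable hf]

theorem eLpNorm_fourierInv {f : V → E} (hf : Integrable f) (hf2 : MemLp f 2) :
    eLpNorm (𝓕⁻ f) 2 volume = eLpNorm f 2 volume := by
  have hcongr : 𝓕⁻ (hf2.toLp f : V → E) = 𝓕⁻ f := by
    ext ξ
    simp only [Real.fourierInv_eq]
    exact integral_congr_ae (by filter_upwards [hf2.coeFn_toLp] with x hx; rw [hx])
  have hae := coeFn_fourierInv_ae_eq (hf2.toLp f) (hf.congr hf2.coeFn_toLp.symm)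
  rw [hcongr] at hae
  rw [← eLpNorm_congr_ae hae, ← eLpNorm_congr_ae hf2.coeFn_toLp, ← Lp.enorm_def, ← Lp.enorm_def]
  exact (Lp.fourierTransformₗᵢ V E).symm.enorm_map _

end FourierInv

section Dilation

open Module

variable {V E : Type*} [NormedAddCommGroup V] [NormedSpace ℝ V] [FiniteDimensional ℝ V]
  [MeasurableSpace V] [BorelSpace V] {μ : Measure V} [μ.IsAddHaarMeasure] [NormedAddCommGroup E]
  {p : ENNReal} {c : ℝ}

theorem eLpNorm_comp_smul (hc : c ≠ 0) (f : V → E) :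
    eLpNorm (fun x => f (c • x)) p μ =
      ENNReal.ofReal |(c ^ finrank ℝ V)⁻¹| ^ (1 / p).toReal * eLpNorm f p μ := by
  have hmap := (Homeomorph.smulOfNeZero c hc).measurableEmbedding.eLpNorm_map_measure (g := f)
    (μ := μ) (p := p)
  rw [show ⇑(Homeomorph.smulOfNeZero c hc) = ((c • ·) : V → V) from rfl,
    Measure.map_addHaar_smul μ hc, eLpNorm_smul_measure_of_ne_zero (by simp [hc]), smul_eq_mul]
    at hmap
  exact hmap.symm

theorem memLp_comp_smul (hc : c ≠ 0) {f : V → E} (hf : MemLp f p μ) :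
    MemLp (fun x => f (c • x)) p μ := by
  refine ⟨hf.1.comp_quasiMeasurePreserving (Measure.quasiMeasurePreserving_smul μ hc), ?_⟩
  rw [eLpNorm_comp_smul hc]
  exact ENNReal.mul_lt_top (ENNReal.rpow_lt_top_of_nonneg ENNReal.toReal_nonneg
    ENNReal.ofReal_ne_top) hf.2

variable {𝕜 : Type*} [NormedField 𝕜] [NormedSpace 𝕜 E] [Fact (1 ≤ p)]

variable (𝕜) in
/-- The dilation `f ↦ f (c • ·)` as a bounded operator on `Lp`. -/
def dilation (hc : c ≠ 0) : Lp E p μ →L[𝕜] Lp E p μ :=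
  LinearMap.mkContinuous
    { toFun := fun f => (memLp_comp_smul hc (Lp.memLp f)).toLp
      map_add' := fun f g => by
        rw [← MemLp.toLp_add]
        exact MemLp.toLp_congr _ _
          ((Measure.quasiMeasurePreserving_smul μ hc).ae_eq_comp (Lp.coeFn_add f g))
      map_smul' := fun a f => by
        rw [RingHom.id_apply, ← MemLp.toLp_const_smul]
        exact MemLp.toLp_congr _ _
          ((Measure.quasiMeasurePreserving_smul μ hc).ae_eq_comp (Lp.coeFn_smul a f)) }
    (ENNReal.ofReal |(c ^ finrank ℝ V)⁻¹| ^ (1 / p).toReal).toReal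
    fun f => by
      rw [LinearMap.coe_mk, AddHom.coe_mk, Lp.norm_toLp, eLpNorm_comp_smul hc,
        ENNReal.toReal_mul, Lp.norm_def]

theorem coeFn_dilation (hc : c ≠ 0) (f : Lp E p μ) :
    dilation 𝕜 hc f =ᵐ[μ] fun x => f (c • x) :=
  MemLp.coeFn_toLp (memLp_comp_smul hc (Lp.memLp f))

end Dilation

section AngularFourier

open FourierTransform

variable {E : Type*} [NormedAddCommGroup E]

theorem eLpNorm_two_sq {α : Type*} [MeasurableSpace α] {μ : Measure α} (g : α → E) :
    eLpNorm g 2 μ ^ 2 = ∫⁻ x, ‖g x‖ₑ ^ 2 ∂μ := by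
  simpa using eLpNorm_nnreal_pow_eq_lintegral (f := g) (μ := μ) (p := 2) two_ne_zero

/-- The Fourier integral in the angular frequency convention and with a positive sign in the
exponent, as opposed to Mathlib's `𝓕 ψ x = ∫ y, exp (-2πixy) • ψ y`. -/
def angularFourier [NormedSpace ℂ E] (ψ : ℝ → E) (x : ℝ) : E :=
  ∫ y : ℝ, Complex.exp (Complex.I * x * y) • ψ y

theorem angularFourier_congr [NormedSpace ℂ E] {ψ φ : ℝ → E} (h : ψ =ᵐ[volume] φ) :
    angularFourier ψ = angularFourier φ := by
  ext x
  exact integral_congr_ae (by filter_upwards [h] with y hy; rw [hy])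

theorem angularFourier_eq_fourierInv [NormedSpace ℂ E] (ψ : ℝ → E) (x : ℝ) :
    angularFourier ψ x = 𝓕⁻ ψ ((2 * Real.pi)⁻¹ * x) := by
  rw [Real.fourierInv_eq, angularFourier]
  refine integral_congr_ae (.of_forall fun y => ?_)
  simp only [Circle.smul_def, Real.fourierChar_apply, RCLike.inner_apply, conj_trivial]
  congr 2
  push_cast
  field_simp

variable [InnerProductSpace ℂ E] [CompleteSpace E]

theorem lintegral_enorm_angularFourier_mul {f : ℝ → E} (hf : Integrable f) (hf2 : MemLp f 2)
    {c : ℝ} (hc : 0 < c) :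
    ∫⁻ x, ‖angularFourier f (c * x)‖ₑ ^ 2 =
      ENNReal.ofReal (2 * Real.pi / c) * ∫⁻ x, ‖f x‖ₑ ^ 2 := by
  have hc' : 0 < (2 * Real.pi)⁻¹ * c := mul_pos (inv_pos.2 Real.two_pi_pos) hc
  have hdil : (fun x => angularFourier f (c * x)) =
      fun x => 𝓕⁻ f (((2 * Real.pi)⁻¹ * c) • x) := by
    ext x
    rw [angularFourier_eq_fourierInv, smul_eq_mul, mul_assoc]
  rw [← eLpNorm_two_sq, hdil, eLpNorm_comp_smul hc'.ne', eLpNorm_fourierInv hf hf2, mul_pow,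
    eLpNorm_two_sq, ← ENNReal.rpow_natCast, ← ENNReal.rpow_mul, Module.finrank_self, pow_one,
    abs_of_pos (inv_pos.2 hc')]
  simp [mul_comm, div_eq_mul_inv]

theorem inv_two_pi_ne_zero : (2 * Real.pi)⁻¹ ≠ 0 := inv_ne_zero Real.two_pi_pos.ne'

variable (E) in
/-- The extension of `angularFourier` from `L¹ ∩ L²` to `L²`. -/
def angularFourierL2 : Lp E 2 (volume : Measure ℝ) →L[ℂ] Lp E 2 (volume : Measure ℝ) :=
  dilation ℂ inv_two_pi_ne_zero ∘L
    (Lp.fourierTransformₗᵢ ℝ E).symm.toLinearIsometry.toContinuousLinearMap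

theorem coeFn_angularFourierL2 (ψ : Lp E 2 (volume : Measure ℝ)) (hψ : Integrable ψ) :
    angularFourierL2 E ψ =ᵐ[volume] angularFourier ψ := by
  refine (coeFn_dilation (𝕜 := ℂ) inv_two_pi_ne_zero _).trans ?_
  filter_upwards [(Measure.quasiMeasurePreserving_smul volume inv_two_pi_ne_zero).ae_eq_comp
    (coeFn_fourierInv_ae_eq ψ hψ)] with x hx
  rw [angularFourier_eq_fourierInv]
  exact hx

end AngularFourier

theorem dense_integrable {α E : Type*} [MeasurableSpace α] {μ : Measure α}
    [NormedAddCommGroup E] {p : ENNReal} [Fact (1 ≤ p)] (hp : p ≠ ⊤) :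
    Dense {ψ : Lp E p μ | Integrable ψ μ} := by
  refine (Lp.simpleFunc.dense hp).mono fun f hf => ?_
  have hp₀ : p ≠ 0 := (zero_lt_one.trans_le Fact.out).ne'
  exact ((SimpleFunc.memLp_iff_integrable hp₀ hp).1 (Lp.simpleFunc.memLp ⟨f, hf⟩)).congr
    (Lp.simpleFunc.toSimpleFunc_eq_toFun ⟨f, hf⟩)

section Exp

variable {𝔸 : Type*} [NormedRing 𝔸]

theorem norm_pow_succ_sub_pow_succ_le {a b : 𝔸} {r : ℝ} (ha : ‖a‖ ≤ r) (hb : ‖b‖ ≤ r) (n : ℕ) :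
    ‖a ^ (n + 1) - b ^ (n + 1)‖ ≤ (n + 1) * r ^ n * ‖a - b‖ := by
  have hr : 0 ≤ r := (norm_nonneg a).trans ha
  induction n with
  | zero => simp
  | succ n ih =>
    calc ‖a ^ (n + 1 + 1) - b ^ (n + 1 + 1)‖
        = ‖a ^ (n + 1) * (a - b) + (a ^ (n + 1) - b ^ (n + 1)) * b‖ := by
          rw [pow_succ a (n + 1), pow_succ b (n + 1)]; congr 1; noncomm_ring
      _ ≤ ‖a ^ (n + 1)‖ * ‖a - b‖ + ‖a ^ (n + 1) - b ^ (n + 1)‖ * ‖b‖ :=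
          (norm_add_le _ _).trans (add_le_add (norm_mul_le _ _) (norm_mul_le _ _))
      _ ≤ r ^ (n + 1) * ‖a - b‖ + ((n + 1) * r ^ n * ‖a - b‖) * r := by
          gcongr
          exact (norm_pow_le' a n.succ_pos).trans (by gcongr)
      _ = _ := by push_cast; ring

variable [CompleteSpace 𝔸]

theorem contDiff_exp (𝕜 : Type*) [RCLike 𝕜] [NormedAlgebra 𝕜 𝔸] {n : WithTop ℕ∞} :
    ContDiff 𝕜 n (NormedSpace.exp : 𝔸 → 𝔸) :=
  contDiff_iff_contDiffAt.2 fun a => (NormedSpace.exp_analytic a).contDiffAt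

variable [NormedAlgebra ℝ 𝔸]

theorem norm_exp_sub_exp_le {a b : 𝔸} {r : ℝ} (ha : ‖a‖ ≤ r) (hb : ‖b‖ ≤ r) :
    ‖NormedSpace.exp a - NormedSpace.exp b‖ ≤ Real.exp r * ‖a - b‖ := by
  have hdiff := (hasSum_nat_add_iff' 1).2 ((NormedSpace.exp_series_hasSum_exp' (𝕂 := ℝ) a).sub
    (NormedSpace.exp_series_hasSum_exp' (𝕂 := ℝ) b))
  simp only [Finset.range_one, Finset.sum_singleton, pow_zero, sub_self, sub_zero] at hdiff
  have hbound : HasSum (fun n : ℕ => r ^ n / n.factorial * ‖a - b‖) (Real.exp r * ‖a - b‖) := by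
    rw [Real.exp_eq_exp_ℝ]
    exact (NormedSpace.expSeries_div_hasSum_exp r).mul_right _
  rw [← hdiff.tsum_eq]
  refine tsum_of_norm_bounded hbound fun n => ?_
  calc ‖((n + 1).factorial : ℝ)⁻¹ • a ^ (n + 1) - ((n + 1).factorial : ℝ)⁻¹ • b ^ (n + 1)‖
      = ((n + 1) * n.factorial : ℝ)⁻¹ * ‖a ^ (n + 1) - b ^ (n + 1)‖ := by
        rw [← smul_sub, norm_smul, norm_inv, Real.norm_natCast, Nat.factorial_succ]
        push_cast
        rfl
    _ ≤ ((n + 1) * n.factorial : ℝ)⁻¹ * ((n + 1) * r ^ n * ‖a - b‖) := by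
        gcongr
        exact norm_pow_succ_sub_pow_succ_le ha hb n
    _ = r ^ n / n.factorial * ‖a - b‖ := by field_simp

theorem norm_exp_le [NormOneClass 𝔸] (a : 𝔸) : ‖NormedSpace.exp a‖ ≤ Real.exp ‖a‖ := by
  rw [← (NormedSpace.exp_series_hasSum_exp' (𝕂 := ℝ) a).tsum_eq, Real.exp_eq_exp_ℝ]
  refine tsum_of_norm_bounded (NormedSpace.expSeries_div_hasSum_exp ‖a‖) fun n => ?_
  rw [norm_smul, norm_inv, Real.norm_natCast, inv_mul_eq_div]
  gcongr
  exact norm_pow_le a n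

end Exp

section Laplace

variable {𝔸 E : Type*} [NormedRing 𝔸] [NormedAlgebra ℝ 𝔸] [CompleteSpace 𝔸]
  [NormedAddCommGroup E] [Module 𝔸 E] [IsBoundedSMul 𝔸 E] {μ : Measure ℝ} {φ : ℝ → E}

theorem aestronglyMeasurable_exp_smul_smul (hφ : AEStronglyMeasurable φ μ) (q : 𝔸) :
    AEStronglyMeasurable (fun t : ℝ => NormedSpace.exp (t • q) • φ t) μ :=
  ((contDiff_exp ℝ (n := 0)).continuous.comp
    (continuous_id.smul continuous_const)).aestronglyMeasurable.smul hφ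

variable (𝕜 : Type*) [RCLike 𝕜] [NormedAlgebra 𝕜 𝔸] [NormedSpace 𝕜 E] [IsScalarTower 𝕜 𝔸 E]

theorem hasFDerivAt_exp_smul_smul [SMulCommClass ℝ 𝕜 𝔸] (t : ℝ) (v : E) (q : 𝔸) :
    HasFDerivAt (fun q : 𝔸 => NormedSpace.exp (t • q) • v)
      ((ContinuousLinearMap.lsmul 𝕜 𝔸).flip v ∘L
        (t • fderiv 𝕜 (NormedSpace.exp : 𝔸 → 𝔸) (t • q))) q := by
  have hexp : HasFDerivAt (fun q : 𝔸 => NormedSpace.exp (t • q))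
      (t • fderiv 𝕜 (NormedSpace.exp : 𝔸 → 𝔸) (t • q)) q := by
    have hd : DifferentiableAt 𝕜 (NormedSpace.exp : 𝔸 → 𝔸) (t • q) :=
      (contDiff_exp 𝕜).differentiable one_ne_zero _
    have := hd.hasFDerivAt.comp q ((hasFDerivAt_id q).const_smul t)
    rwa [ContinuousLinearMap.comp_smul, ContinuousLinearMap.comp_id] at this
  exact ((ContinuousLinearMap.lsmul 𝕜 𝔸).flip v).hasFDerivAt.comp q hexp

variable [NormedSpace ℝ E]

theorem aestronglyMeasurable_of_integrable_exp_abs_smul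
    (hφ : ∀ c : ℝ, Integrable (fun t => Real.exp (c * |t|) • φ t) μ) :
    AEStronglyMeasurable φ μ := by
  simpa using (hφ 0).1

theorem integrable_exp_smul_smul [NormOneClass 𝔸]
    (hφ : ∀ c : ℝ, Integrable (fun t => Real.exp (c * |t|) • φ t) μ) (q : 𝔸) :
    Integrable (fun t : ℝ => NormedSpace.exp (t • q) • φ t) μ := by
  refine (hφ ‖q‖).mono (aestronglyMeasurable_exp_smul_smul
    (aestronglyMeasurable_of_integrable_exp_abs_smul hφ) q) (.of_forall fun t => ?_)
  calc ‖NormedSpace.exp (t • q) • φ t‖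
      ≤ ‖NormedSpace.exp (t • q)‖ * ‖φ t‖ := norm_smul_le _ _
    _ ≤ Real.exp ‖t • q‖ * ‖φ t‖ := by gcongr; exact norm_exp_le _
    _ = ‖Real.exp (‖q‖ * |t|) • φ t‖ := by
        rw [norm_smul, norm_smul, Real.norm_of_nonneg (Real.exp_nonneg _), Real.norm_eq_abs,
          mul_comm |t|]

theorem norm_exp_smul_smul_sub_le {q₀ q : 𝔸} (hq : q ∈ Metric.ball q₀ 1) (t : ℝ) (v : E) :
    ‖NormedSpace.exp (t • q) • v - NormedSpace.exp (t • q₀) • v‖ ≤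
      ‖Real.exp ((‖q₀‖ + 2) * |t|) • v‖ * ‖q - q₀‖ := by
  rw [Metric.mem_ball, dist_eq_norm] at hq
  have hscale {p : 𝔸} (hp : ‖p‖ ≤ ‖q₀‖ + 1) : ‖t • p‖ ≤ (‖q₀‖ + 1) * |t| := by
    rw [norm_smul, Real.norm_eq_abs, mul_comm]
    gcongr
  have hexp := norm_exp_sub_exp_le
    (hscale (p := q) (by linarith [norm_le_norm_add_norm_sub' q q₀]))
    (hscale (p := q₀) (by linarith))
  have habs : |t| ≤ Real.exp |t| := by linarith [Real.add_one_le_exp |t|]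
  rw [← smul_sub, norm_smul, Real.norm_eq_abs] at hexp
  calc ‖NormedSpace.exp (t • q) • v - NormedSpace.exp (t • q₀) • v‖
      ≤ ‖NormedSpace.exp (t • q) - NormedSpace.exp (t • q₀)‖ * ‖v‖ := by
        rw [← sub_smul]; exact norm_smul_le _ _
    _ ≤ (Real.exp ((‖q₀‖ + 1) * |t|) * (Real.exp |t| * ‖q - q₀‖)) * ‖v‖ := by
        gcongr
        exact hexp.trans (by gcongr)
    _ = ‖Real.exp ((‖q₀‖ + 2) * |t|) • v‖ * ‖q - q₀‖ := by
        rw [norm_smul, Real.norm_of_nonneg (Real.exp_nonneg _),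
          show (‖q₀‖ + 2) * |t| = (‖q₀‖ + 1) * |t| + |t| by ring, Real.exp_add]
        ring

theorem differentiable_integral_exp_smul_smul [NormOneClass 𝔸] [SMulCommClass ℝ 𝕜 𝔸]
    (hφ : ∀ c : ℝ, Integrable (fun t => Real.exp (c * |t|) • φ t) μ) :
    Differentiable 𝕜 fun q : 𝔸 => ∫ t, NormedSpace.exp (t • q) • φ t ∂μ := by
  intro q₀
  have hm := aestronglyMeasurable_of_integrable_exp_abs_smul hφ
  have hm' : AEStronglyMeasurable (fun t : ℝ => (ContinuousLinearMap.lsmul 𝕜 𝔸).flip (φ t) ∘L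
      (t • fderiv 𝕜 (NormedSpace.exp : 𝔸 → 𝔸) (t • q₀))) μ :=
    (ContinuousLinearMap.compL 𝕜 𝔸 𝔸 E).aestronglyMeasurable_comp₂
      ((ContinuousLinearMap.lsmul 𝕜 𝔸).flip.continuous.comp_aestronglyMeasurable hm)
      (continuous_id.smul (((contDiff_exp 𝕜).continuous_fderiv one_ne_zero).comp
        (continuous_id.smul continuous_const))).aestronglyMeasurable
  exact (hasFDerivAt_integral_of_dominated_loc_of_lip' (Metric.ball_mem_nhds q₀ one_pos)
    (fun q _ => aestronglyMeasurable_exp_smul_smul hm q) (integrable_exp_smul_smul hφ q₀) hm'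
    (.of_forall fun t q hq => norm_exp_smul_smul_sub_le hq t (φ t)) (hφ _).norm
    (.of_forall fun t => hasFDerivAt_exp_smul_smul 𝕜 t (φ t) q₀)).2.differentiableAt

end Laplace

section Gaussian

variable {ν : ℝ} {E : Type*} [NormedAddCommGroup E] [NormedSpace ℝ E] {ψ : ℝ → E}

theorem memLp_exp_abs_mul_gaussian (hν : 0 < ν) (c : ℝ) :
    MemLp (fun t : ℝ => Real.exp (c * |t|) * Real.exp (-ν / 2 * t ^ 2)) 2 := by
  have hdom : MemLp (fun t : ℝ => Real.exp (c ^ 2 / ν) * Real.exp (-(ν / 4) * t ^ 2)) 2 := by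
    refine MemLp.const_mul ?_ _
    rw [memLp_two_iff_integrable_sq (by fun_prop)]
    refine (integrable_exp_neg_mul_sq (half_pos hν)).congr (.of_forall fun t => ?_)
    simp only [← Real.exp_nat_mul]
    ring_nf
  refine hdom.mono (by fun_prop) (.of_forall fun t => ?_)
  rw [← Real.exp_add, ← Real.exp_add, Real.norm_of_nonneg (Real.exp_nonneg _),
    Real.norm_of_nonneg (Real.exp_nonneg _), Real.exp_le_exp]
  have hsq : 0 ≤ (ν * |t| - 2 * c) ^ 2 / (4 * ν) := by positivity
  have hexpand : (ν * |t| - 2 * c) ^ 2 / (4 * ν) = ν / 4 * t ^ 2 - c * |t| + c ^ 2 / ν := by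
    rw [← sq_abs t]; field_simp; ring
  linarith

theorem memLp_gaussian (hν : 0 < ν) : MemLp (fun t : ℝ => Real.exp (-ν / 2 * t ^ 2)) 2 := by
  simpa using memLp_exp_abs_mul_gaussian hν 0

theorem integrable_exp_abs_smul_gaussian_smul (hν : 0 < ν) (hψ : MemLp ψ 2) (c : ℝ) :
    Integrable fun t : ℝ => Real.exp (c * |t|) • Real.exp (-ν / 2 * t ^ 2) • ψ t :=
  (memLp_one_iff_integrable.1 (hψ.smul (memLp_exp_abs_mul_gaussian hν c))).congr
    (.of_forall fun _ => mul_smul _ _ _)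

theorem memLp_gaussian_sub_smul (hν : 0 ≤ ν) (hψ : MemLp ψ 2) (a : ℝ) :
    MemLp (fun t : ℝ => Real.exp (-ν / 2 * (t - a) ^ 2) • ψ t) 2 := by
  have hcont : Continuous fun t : ℝ => Real.exp (-ν / 2 * (t - a) ^ 2) := by fun_prop
  refine hψ.mono (hcont.aestronglyMeasurable.smul hψ.1) (.of_forall fun t => ?_)
  rw [norm_smul, Real.norm_of_nonneg (Real.exp_nonneg _)]
  refine mul_le_of_le_one_left (norm_nonneg _) (Real.exp_le_one_iff.2 ?_)
  nlinarith [mul_nonneg hν (sq_nonneg (t - a))]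

theorem integrable_gaussian_sub_smul (hν : 0 < ν) (hψ : MemLp ψ 2) (a : ℝ) :
    Integrable fun t : ℝ => Real.exp (-ν / 2 * (t - a) ^ 2) • ψ t :=
  memLp_one_iff_integrable.1 (hψ.smul (φ := fun t : ℝ => Real.exp (-ν / 2 * (t - a) ^ 2))
    ((memLp_gaussian hν).comp_measurePreserving (measurePreserving_sub_right volume a)))

end Gaussian

section Kernel

variable {𝔸 : Type*} [NormedRing 𝔸] [NormedAlgebra ℝ 𝔸] {ν : ℝ}

/-- The normalising constant of the Bargmann kernel. -/
def kappa (ν : ℝ) : ℝ := (ν / Real.pi) ^ (3 / 4 : ℝ)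

/-- The Bargmann kernel with argument in a real Banach algebra: the classical one on `ℂ`, the slice
hyperholomorphic one on `ℍ`. -/
def bargmannKernel (ν : ℝ) (q : 𝔸) (t : ℝ) : 𝔸 :=
  kappa ν • NormedSpace.exp ((-ν / 2) • (q ^ 2 + algebraMap ℝ 𝔸 t ^ 2) +
    (ν * √2) • (q * algebraMap ℝ 𝔸 t))

theorem kappa_nonneg (hν : 0 ≤ ν) : 0 ≤ kappa ν := by unfold kappa; positivity

theorem kappa_sq_mul_sqrt (hν : 0 ≤ ν) : kappa ν ^ 2 * √(Real.pi / ν) = ν / Real.pi := by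
  have hx : 0 ≤ ν / Real.pi := by positivity
  rw [kappa, ← Real.rpow_natCast, ← Real.rpow_mul hx, ← inv_div ν, Real.sqrt_inv,
    Real.sqrt_eq_rpow]
  rcases hx.eq_or_lt with h | h
  · simp [← h]
  · rw [← Real.rpow_neg hx, ← Real.rpow_add h]
    norm_num

theorem map_bargmannKernel {𝔹 : Type*} [CompleteSpace 𝔸] [NormedRing 𝔹] [NormedAlgebra ℝ 𝔹]
    (f : 𝔸 →ₐ[ℝ] 𝔹) (hf : Continuous f) (q : 𝔸) (t : ℝ) :
    f (bargmannKernel ν q t) = bargmannKernel ν (f q) t := by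
  let _ : NormedAlgebra ℚ 𝔸 := NormedAlgebra.restrictScalars ℚ ℝ 𝔸
  let _ : NormedAlgebra ℚ 𝔹 := NormedAlgebra.restrictScalars ℚ ℝ 𝔹
  simp [bargmannKernel, NormedSpace.map_exp f hf]

theorem bargmannKernel_complex (z : ℂ) (t : ℝ) :
    bargmannKernel ν z t =
      kappa ν * Complex.exp (-ν / 2 * (z ^ 2 + t ^ 2) + ν * √2 * (z * t)) := by
  simp only [bargmannKernel, Complex.exp_eq_exp_ℂ, Complex.real_smul, Complex.coe_algebraMap]
  push_cast
  rfl

theorem exp_algebraMap (s : ℝ) :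
    NormedSpace.exp (algebraMap ℝ 𝔸 s) = algebraMap ℝ 𝔸 (Real.exp s) := by
  rw [Real.exp_eq_exp_ℝ, NormedSpace.algebraMap_exp_comm]

variable [CompleteSpace 𝔸]

theorem bargmannKernel_eq_mul (q : 𝔸) (t : ℝ) :
    bargmannKernel ν q t = (kappa ν • NormedSpace.exp ((-ν / 2) • q ^ 2)) *
      (Real.exp (-ν / 2 * t ^ 2) • NormedSpace.exp (t • (ν * √2) • q)) := by
  let _ : NormedAlgebra ℚ 𝔸 := NormedAlgebra.restrictScalars ℚ ℝ 𝔸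
  have hsplit : (-ν / 2) • (q ^ 2 + algebraMap ℝ 𝔸 t ^ 2) + (ν * √2) • (q * algebraMap ℝ 𝔸 t) =
      (-ν / 2) • q ^ 2 + (algebraMap ℝ 𝔸 (-ν / 2 * t ^ 2) + t • (ν * √2) • q) := by
    rw [smul_add, add_assoc, ← Algebra.commutes, ← Algebra.smul_def, smul_comm t, map_mul, map_pow,
      ← Algebra.smul_def]
  have hcomm : Commute ((-ν / 2) • q ^ 2) (algebraMap ℝ 𝔸 (-ν / 2 * t ^ 2) + t • (ν * √2) • q) :=
    (Algebra.commute_algebraMap_right _ _).add_right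
      (((((Commute.refl q).pow_left 2).smul_left _).smul_right _).smul_right _)
  rw [bargmannKernel, hsplit, NormedSpace.exp_add_of_commute hcomm,
    NormedSpace.exp_add_of_commute (Algebra.commute_algebraMap_left _ _), exp_algebraMap,
    ← Algebra.smul_def, smul_mul_assoc]

theorem continuous_bargmannKernel (ν : ℝ) (q : 𝔸) : Continuous (bargmannKernel ν q) := by
  have := (contDiff_exp ℝ (𝔸 := 𝔸) (n := 0)).continuous
  have := algebraMapCLM ℝ 𝔸 |>.continuous
  unfold bargmannKernel
  fun_prop

theorem memLp_bargmannKernel [NormOneClass 𝔸] (hν : 0 < ν) (q : 𝔸) :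
    MemLp (bargmannKernel ν q) 2 := by
  refine ((memLp_exp_abs_mul_gaussian hν ‖(ν * √2) • q‖).const_mul
    ‖kappa ν • NormedSpace.exp ((-ν / 2) • q ^ 2)‖).mono
    (continuous_bargmannKernel ν q).aestronglyMeasurable (.of_forall fun t => ?_)
  rw [bargmannKernel_eq_mul, norm_mul ‖_‖, norm_norm, mul_comm (Real.exp _),
    Real.norm_of_nonneg (by positivity)]
  refine (norm_mul_le _ _).trans ?_
  rw [norm_smul (Real.exp _), Real.norm_of_nonneg (Real.exp_nonneg _)]
  gcongr
  refine (norm_exp_le _).trans_eq ?_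
  rw [norm_smul, Real.norm_eq_abs, mul_comm]

theorem integrable_bargmannKernel_smul [NormOneClass 𝔸] {E : Type*} [NormedAddCommGroup E]
    [Module 𝔸 E] [IsBoundedSMul 𝔸 E] {ψ : ℝ → E} (hν : 0 < ν) (hψ : MemLp ψ 2) (q : 𝔸) :
    Integrable fun t => bargmannKernel ν q t • ψ t :=
  memLp_one_iff_integrable.1 (hψ.smul (memLp_bargmannKernel hν q))

end Kernel

section Transform

variable {𝔸 E : Type*} [NormedRing 𝔸] [NormedAlgebra ℝ 𝔸] [NormedAddCommGroup E] [NormedSpace ℝ E]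
  [Module 𝔸 E] {ν : ℝ} {ψ φ : ℝ → E}

/-- The Bargmann transform of functions with values in a module over a real Banach algebra, as a
function on this algebra. -/
def bargmann (ν : ℝ) (ψ : ℝ → E) (q : 𝔸) : E := ∫ t, bargmannKernel ν q t • ψ t

theorem bargmann_congr (h : ψ =ᵐ[volume] φ) :
    (bargmann ν ψ : 𝔸 → E) = bargmann ν φ := by
  ext q
  exact integral_congr_ae (by filter_upwards [h] with t ht; rw [ht])

theorem bargmann_const_smul {𝕜 : Type*} [RCLike 𝕜] [NormedSpace 𝕜 E] [SMulCommClass ℝ 𝕜 E]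
    [SMulCommClass 𝔸 𝕜 E] (c : 𝕜) (ψ : ℝ → E) :
    (bargmann ν (c • ψ) : 𝔸 → E) = c • bargmann ν ψ := by
  ext q
  simp only [bargmann, Pi.smul_apply, smul_comm _ c]
  exact integral_smul _ _

variable [CompleteSpace 𝔸] [NormOneClass 𝔸] [IsBoundedSMul 𝔸 E]

theorem bargmann_add (hν : 0 < ν) (hψ : MemLp ψ 2) (hφ : MemLp φ 2) :
    (bargmann ν (ψ + φ) : 𝔸 → E) = bargmann ν ψ + bargmann ν φ := by
  ext q
  simp only [bargmann, Pi.add_apply, smul_add]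
  exact integral_add (integrable_bargmannKernel_smul hν hψ q)
    (integrable_bargmannKernel_smul hν hφ q)

variable [IsScalarTower ℝ 𝔸 E] [SMulCommClass ℝ 𝔸 E]

theorem bargmann_eq_smul_integral [CompleteSpace E] (hν : 0 < ν) (hψ : MemLp ψ 2) (q : 𝔸) :
    bargmann ν ψ q = (kappa ν • NormedSpace.exp ((-ν / 2) • q ^ 2)) •
      ∫ t : ℝ, NormedSpace.exp (t • (ν * √2) • q) • Real.exp (-ν / 2 * t ^ 2) • ψ t := by
  rw [← (integrable_exp_smul_smul (integrable_exp_abs_smul_gaussian_smul hν hψ) _).integral_smul]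
  refine integral_congr_ae (.of_forall fun t => ?_)
  simp only [bargmannKernel_eq_mul, mul_smul, smul_assoc]
  rw [smul_comm (Real.exp _)]

theorem differentiable_bargmann [CompleteSpace E] (𝕜 : Type*) [RCLike 𝕜] [NormedAlgebra 𝕜 𝔸]
    [NormedSpace 𝕜 E] [IsScalarTower 𝕜 𝔸 E] [SMulCommClass ℝ 𝕜 𝔸] (hν : 0 < ν) (hψ : MemLp ψ 2) :
    Differentiable 𝕜 (bargmann ν ψ : 𝔸 → E) := by
  have hlaplace := differentiable_integral_exp_smul_smul (𝔸 := 𝔸) 𝕜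
    (integrable_exp_abs_smul_gaussian_smul hν hψ)
  have hexp : Differentiable 𝕜 (NormedSpace.exp : 𝔸 → 𝔸) :=
    (contDiff_exp 𝕜).differentiable one_ne_zero
  have hsq : Differentiable 𝕜 fun q : 𝔸 => (-ν / 2) • q ^ 2 :=
    (differentiable_id.pow 2).fun_const_smul _
  have hlin : Differentiable 𝕜 fun q : 𝔸 => (ν * √2) • q := differentiable_fun_id.fun_const_smul _
  rw [funext (bargmann_eq_smul_integral hν hψ)]
  exact ((hexp.comp hsq).fun_const_smul (kappa ν)).fun_smul (hlaplace.comp hlin)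

end Transform

section Isometry

theorem lintegral_complex_eq {f : ℂ → ENNReal} (hf : Measurable f) :
    ∫⁻ z, f z = ∫⁻ x : ℝ, ∫⁻ y : ℝ, f (x + y * Complex.I) := by
  rw [← Complex.volume_preserving_equiv_real_prod.symm.lintegral_comp hf,
    Measure.volume_eq_prod, lintegral_prod
      (fun a : ℝ × ℝ => f (Complex.measurableEquivRealProd.symm a))
      (hf.comp Complex.measurableEquivRealProd.symm.measurable).aemeasurable]
  simp only [Complex.measurableEquivRealProd_symm_apply, Complex.mk_eq_add_mul_I]

theorem lintegral_gaussian_sub_mul {b c : ℝ} (hb : 0 < b) (hc : 0 < c) (t : ℝ) :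
    ∫⁻ x : ℝ, ENNReal.ofReal (Real.exp (-b * (t - c * x) ^ 2)) =
      ENNReal.ofReal (√(Real.pi / b) / c) := by
  have hint : Integrable fun x => Real.exp (-b * (t - c * x) ^ 2) :=
    ((integrable_exp_neg_mul_sq hb).comp_sub_left t).comp_mul_left' hc.ne'
  rw [← ofReal_integral_eq_lintegral_ofReal hint (.of_forall fun _ => Real.exp_nonneg _),
    Measure.integral_comp_mul_left (fun u => Real.exp (-b * (t - u) ^ 2)),
    integral_sub_left_eq_self (fun u => Real.exp (-b * u ^ 2)), integral_gaussian,
    abs_of_pos (inv_pos.2 hc), smul_eq_mul, inv_mul_eq_div]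

section NormedSpace

variable {E : Type*} [NormedAddCommGroup E] [NormedSpace ℂ E] {ν : ℝ} {ψ : ℝ → E}

/-- The Bargmann transform multiplied by the square root of the Gaussian weight of the Fock
space. -/
def weightedBargmann (ν : ℝ) (ψ : ℝ → E) (z : ℂ) : E :=
  Real.exp (-ν / 2 * ‖z‖ ^ 2) • bargmann ν ψ z

theorem exp_normSq_mul_bargmannKernel (ν x y t : ℝ) :
    Real.exp (-ν / 2 * ‖(x + y * Complex.I : ℂ)‖ ^ 2) * bargmannKernel ν (x + y * Complex.I : ℂ) t =
      kappa ν * Complex.exp ((-(ν * x * y) : ℝ) * Complex.I) *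
        (Complex.exp (Complex.I * (ν * √2 * y : ℝ) * t) *
          Real.exp (-ν / 2 * (t - √2 * x) ^ 2)) := by
  have hnorm : ‖(x + y * Complex.I : ℂ)‖ ^ 2 = x ^ 2 + y ^ 2 := by
    rw [← Complex.normSq_eq_norm_sq, Complex.normSq_add_mul_I]
  have hsqrt : ((√2 : ℝ) : ℂ) ^ 2 = 2 := by norm_cast; exact Real.sq_sqrt zero_le_two
  rw [bargmannKernel_complex, hnorm, mul_left_comm, mul_assoc (kappa ν : ℂ)]
  push_cast
  rw [← Complex.exp_add, ← Complex.exp_add, ← Complex.exp_add]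
  congr 2
  linear_combination (-ν * y ^ 2 / 2) * Complex.I_sq + (ν * x ^ 2 / 2) * hsqrt

theorem weightedBargmann_eq_angularFourier (ν : ℝ) (ψ : ℝ → E) (x y : ℝ) :
    weightedBargmann ν ψ (x + y * Complex.I) =
      ((kappa ν : ℂ) * Complex.exp ((-(ν * x * y) : ℝ) * Complex.I)) •
        angularFourier (fun t => Real.exp (-ν / 2 * (t - √2 * x) ^ 2) • ψ t) (ν * √2 * y) := by
  rw [weightedBargmann, bargmann, angularFourier, ← integral_smul, ← integral_smul]
  refine integral_congr_ae (.of_forall fun t => ?_)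
  simp only [← Complex.coe_smul, smul_smul]
  rw [exp_normSq_mul_bargmannKernel]

theorem enorm_weightedBargmann_sq (hν : 0 < ν) (ψ : ℝ → E) (x y : ℝ) :
    ‖weightedBargmann ν ψ (x + y * Complex.I)‖ₑ ^ 2 = ENNReal.ofReal (kappa ν ^ 2) *
      ‖angularFourier (fun t => Real.exp (-ν / 2 * (t - √2 * x) ^ 2) • ψ t) (ν * √2 * y)‖ₑ ^ 2 := by
  rw [weightedBargmann_eq_angularFourier, enorm_smul, mul_pow, ← ofReal_norm (_ * _), norm_mul,
    Complex.norm_exp_ofReal_mul_I, mul_one, Complex.norm_real,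
    Real.norm_of_nonneg (kappa_nonneg hν.le), ENNReal.ofReal_pow (kappa_nonneg hν.le)]

theorem continuous_weightedBargmann [CompleteSpace E] (hν : 0 < ν) (hψ : MemLp ψ 2) :
    Continuous (weightedBargmann ν ψ) :=
  Continuous.smul (f := fun z : ℂ => Real.exp (-ν / 2 * ‖z‖ ^ 2)) (by fun_prop)
    (differentiable_bargmann ℂ hν hψ).continuous

end NormedSpace

variable {E : Type*} [NormedAddCommGroup E] [InnerProductSpace ℂ E] [CompleteSpace E] {ν : ℝ}
  {ψ : ℝ → E}

theorem lintegral_enorm_weightedBargmann_vertical (hν : 0 < ν) (hψ : MemLp ψ 2) (x : ℝ) :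
    ∫⁻ y : ℝ, ‖weightedBargmann ν ψ (x + y * Complex.I)‖ₑ ^ 2 =
      ENNReal.ofReal (kappa ν ^ 2 * (2 * Real.pi / (ν * √2))) *
        ∫⁻ t, ENNReal.ofReal (Real.exp (-ν * (t - √2 * x) ^ 2)) * ‖ψ t‖ₑ ^ 2 := by
  simp_rw [enorm_weightedBargmann_sq hν]
  rw [lintegral_const_mul' _ _ ENNReal.ofReal_ne_top,
    lintegral_enorm_angularFourier_mul (integrable_gaussian_sub_smul hν hψ _)
      (memLp_gaussian_sub_smul hν.le hψ _) (by positivity),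
    ← mul_assoc, ← ENNReal.ofReal_mul (sq_nonneg _)]
  congr 2 with t
  rw [enorm_smul, mul_pow, Real.enorm_of_nonneg (Real.exp_nonneg _),
    ← ENNReal.ofReal_pow (Real.exp_nonneg _), ← Real.exp_nat_mul]
  ring_nf

theorem lintegral_enorm_weightedBargmann (hν : 0 < ν) (hψ : MemLp ψ 2) :
    ∫⁻ z, ‖weightedBargmann ν ψ z‖ₑ ^ 2 = ∫⁻ t, ‖ψ t‖ₑ ^ 2 := by
  have hconst : kappa ν ^ 2 * (2 * Real.pi / (ν * √2)) * (√(Real.pi / ν) / √2) = 1 := by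
    calc kappa ν ^ 2 * (2 * Real.pi / (ν * √2)) * (√(Real.pi / ν) / √2)
        = kappa ν ^ 2 * √(Real.pi / ν) * (2 * Real.pi / (ν * √2 ^ 2)) := by ring
      _ = 1 := by
          rw [kappa_sq_mul_sqrt hν.le, Real.sq_sqrt zero_le_two]
          field_simp
  have hmeas : AEMeasurable (fun p : ℝ × ℝ =>
      ENNReal.ofReal (Real.exp (-ν * (p.2 - √2 * p.1) ^ 2)) * ‖ψ p.2‖ₑ ^ 2)
      (volume.prod volume) :=
    AEMeasurable.mul (by fun_prop) ((hψ.1.enorm.pow_const 2).comp_quasiMeasurePreserving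
      Measure.quasiMeasurePreserving_snd)
  rw [lintegral_complex_eq ((continuous_weightedBargmann hν hψ).enorm.measurable.pow_const 2)]
  simp_rw [lintegral_enorm_weightedBargmann_vertical hν hψ]
  rw [lintegral_const_mul' _ _ ENNReal.ofReal_ne_top, lintegral_lintegral_swap hmeas]
  have hinner (t : ℝ) : ∫⁻ x : ℝ, ENNReal.ofReal (Real.exp (-ν * (t - √2 * x) ^ 2)) * ‖ψ t‖ₑ ^ 2 =
      ENNReal.ofReal (√(Real.pi / ν) / √2) * ‖ψ t‖ₑ ^ 2 := by
    rw [lintegral_mul_const'' _ (by fun_prop), lintegral_gaussian_sub_mul hν (by positivity)]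
  simp_rw [hinner]
  rw [lintegral_const_mul' _ _ ENNReal.ofReal_ne_top, ← mul_assoc,
    ← ENNReal.ofReal_mul (by positivity), hconst, ENNReal.ofReal_one, one_mul]

theorem eLpNorm_weightedBargmann (hν : 0 < ν) (hψ : MemLp ψ 2) :
    eLpNorm (weightedBargmann ν ψ) 2 volume = eLpNorm ψ 2 volume := by
  refine (ENNReal.pow_right_strictMono two_ne_zero).injective ?_
  simp only [eLpNorm_two_sq, lintegral_enorm_weightedBargmann hν hψ]

theorem memLp_weightedBargmann (hν : 0 < ν) (hψ : MemLp ψ 2) : MemLp (weightedBargmann ν ψ) 2 :=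
  ⟨(continuous_weightedBargmann hν hψ).aestronglyMeasurable, by
    rw [eLpNorm_weightedBargmann hν hψ]; exact hψ.2⟩

variable (E) in
/-- The weighted Bargmann transform as an isometry `L²(ℝ; E) → L²(ℂ; E)`. -/
def weightedBargmannL2 (hν : 0 < ν) :
    Lp E 2 (volume : Measure ℝ) →ₗᵢ[ℂ] Lp E 2 (volume : Measure ℂ) where
  toFun ψ := (memLp_weightedBargmann hν (Lp.memLp ψ)).toLp
  map_add' ψ φ := by
    rw [← MemLp.toLp_add]
    refine MemLp.toLp_congr _ _ (.of_forall fun z => ?_)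
    simp only [weightedBargmann, Pi.add_apply, bargmann_congr (Lp.coeFn_add ψ φ),
      bargmann_add hν (Lp.memLp ψ) (Lp.memLp φ), smul_add]
  map_smul' c ψ := by
    rw [RingHom.id_apply, ← MemLp.toLp_const_smul]
    refine MemLp.toLp_congr _ _ (.of_forall fun z => ?_)
    simp only [weightedBargmann, Pi.smul_apply, bargmann_congr (Lp.coeFn_smul c ψ),
      bargmann_const_smul, smul_comm c]
  norm_map' ψ := by
    rw [LinearMap.coe_mk, AddHom.coe_mk, Lp.norm_toLp,
      eLpNorm_weightedBargmann hν (Lp.memLp ψ), Lp.norm_def]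

theorem coeFn_weightedBargmannL2 (hν : 0 < ν) (ψ : Lp E 2 (volume : Measure ℝ)) :
    weightedBargmannL2 E hν ψ =ᵐ[volume] weightedBargmann ν ψ :=
  MemLp.coeFn_toLp (memLp_weightedBargmann hν (Lp.memLp ψ))

theorem injective_bargmann (hν : 0 < ν) :
    Function.Injective fun ψ : Lp E 2 (volume : Measure ℝ) => (bargmann ν ψ : ℂ → E) := by
  intro ψ φ h
  refine (weightedBargmannL2 E hν).injective (Lp.ext ?_)
  refine (coeFn_weightedBargmannL2 hν ψ).trans (.trans (.of_forall fun z => ?_)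
    (coeFn_weightedBargmannL2 hν φ).symm)
  simp only [weightedBargmann, congrFun h z]

end Isometry

section MeanValue

open scoped ComplexConjugate

variable {E : Type*} [NormedAddCommGroup E] [CompleteSpace E]

theorem measurePreserving_circleMap_mul (θ : ℝ) :
    MeasurePreserving fun u : ℂ => circleMap 0 1 θ * u := by
  have hrot : (fun u : ℂ => circleMap 0 1 θ * u) = rotation (Circle.exp θ) := by
    ext u
    simp [circleMap_zero]
  rw [hrot]
  exact (rotation (Circle.exp θ)).measurePreserving

theorem integral_circleAverage_mul [NormedSpace ℝ E] {F : ℂ → E} (hF : Integrable F) :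
    ∫ u : ℂ, Real.circleAverage (fun z => F (z * u)) 0 1 = ∫ u, F u := by
  have hskew := (MeasurePreserving.id (volume.restrict (Set.Ioc 0 (2 * Real.pi)))).skew_product
    (g := fun θ (u : ℂ) => circleMap 0 1 θ * u) (by fun_prop)
    (.of_forall fun θ => (measurePreserving_circleMap_mul θ).map_eq)
  have hprod : Integrable (Function.uncurry fun θ (u : ℂ) => F (circleMap 0 1 θ * u))
      ((volume.restrict (Set.Ioc 0 (2 * Real.pi))).prod volume) :=
    hskew.integrable_comp_of_integrable (hF.comp_snd _)
  have hrot (θ : ℝ) : ∫ u, F (circleMap 0 1 θ * u) = ∫ u, F u := by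
    have hmap := (measurePreserving_circleMap_mul θ).map_eq
    have hF' : AEStronglyMeasurable F (volume.map (circleMap 0 1 θ * ·)) := by
      rw [hmap]
      exact hF.1
    rw [← integral_map (by fun_prop) hF', hmap]
  simp only [Real.circleAverage_def, intervalIntegral.integral_of_le Real.two_pi_pos.le]
  rw [integral_smul, ← integral_integral_swap hprod]
  simp only [hrot, setIntegral_const, Real.volume_real_Ioc_of_le Real.two_pi_pos.le, sub_zero]
  rw [inv_smul_smul₀ Real.two_pi_pos.ne']

variable [NormedSpace ℂ E]

theorem integral_norm_smul_eq_smul_apply_zero {G : ℂ → E} (hG : Differentiable ℂ G) {w : ℝ → ℝ}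
    (hint : Integrable fun u : ℂ => w ‖u‖ • G u) :
    ∫ u : ℂ, w ‖u‖ • G u = (∫ u : ℂ, w ‖u‖) • G 0 := by
  have hmean (u : ℂ) : Real.circleAverage (fun z => G (z * u)) 0 1 = G 0 := by
    have hd : DiffContOnCl ℂ (fun z => G (z * u)) (Metric.ball 0 |1|) :=
      (hG.comp (differentiable_id.mul_const u)).diffContOnCl
    simpa using hd.circleAverage
  rw [← integral_circleAverage_mul hint, ← integral_smul_const]
  refine integral_congr_ae (.of_forall fun u => ?_)
  simp only [← hmean u, ← Real.circleAverage_fun_smul]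
  refine Real.circleAverage_congr_sphere fun z hz => ?_
  have hz' : ‖z‖ = 1 := by simpa using hz
  simp only [norm_mul, hz', one_mul]

theorem integral_gaussian_smul_exp_smul {ν : ℝ} (hν : 0 < ν) {H : ℂ → E} (hH : Differentiable ℂ H)
    (w : ℂ)
    (hint : Integrable fun z : ℂ => Real.exp (-ν * ‖z‖ ^ 2) • Complex.exp (ν * conj z * w) • H z) :
    ∫ z : ℂ, Real.exp (-ν * ‖z‖ ^ 2) • Complex.exp (ν * conj z * w) • H z =
      (Real.pi / ν) • H w := by
  have hshift (u : ℂ) :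
      Real.exp (-ν * ‖u + w‖ ^ 2) • Complex.exp (ν * conj (u + w) * w) • H (u + w) =
        Real.exp (-ν * ‖u‖ ^ 2) • Complex.exp (-(ν * conj w * u)) • H (u + w) := by
    simp only [← Complex.coe_smul, smul_smul]
    push_cast
    rw [← Complex.exp_add, ← Complex.exp_add, ← Complex.mul_conj', ← Complex.mul_conj', map_add]
    ring_nf
  have hG : Differentiable ℂ fun u => Complex.exp (-(ν * conj w * u)) • H (u + w) :=
    Differentiable.fun_smul (by fun_prop) (hH.comp (by fun_prop))
  have hint' := hint.comp_add_right w
  rw [← integral_add_right_eq_self _ w]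
  simp only [hshift] at hint' ⊢
  rw [integral_norm_smul_eq_smul_apply_zero (w := fun r => Real.exp (-ν * r ^ 2)) hG hint',
    GaussianFourier.integral_rexp_neg_mul_sq_norm hν]
  simp

end MeanValue

section CoherentStates

open scoped ComplexConjugate InnerProductSpace

variable {ν : ℝ}

theorem integral_bargmannKernel_mul_bargmannKernel (hν : 0 < ν) (z w : ℂ) :
    ∫ t : ℝ, bargmannKernel ν z t * bargmannKernel ν w t =
      (ν / Real.pi : ℝ) * Complex.exp (ν * z * w) := by
  have hsqrt : ((√2 : ℝ) : ℂ) ^ 2 = 2 := by norm_cast; exact Real.sq_sqrt zero_le_two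
  have hν' : (ν : ℂ) ≠ 0 := by exact_mod_cast hν.ne'
  have hkernel (t : ℝ) : bargmannKernel ν z t * bargmannKernel ν w t = (kappa ν : ℂ) ^ 2 *
      Complex.exp (-ν * t ^ 2 + ν * √2 * (z + w) * t + -ν / 2 * (z ^ 2 + w ^ 2)) := by
    rw [bargmannKernel_complex, bargmannKernel_complex, mul_mul_mul_comm, ← Complex.exp_add, ← sq]
    ring_nf
  have hroot : ((Real.pi : ℂ) / - -ν) ^ (1 / 2 : ℂ) = (√(Real.pi / ν) : ℝ) := by
    rw [neg_neg, Real.sqrt_eq_rpow, Complex.ofReal_cpow (by positivity)]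
    norm_num
  have hexponent : -ν / 2 * (z ^ 2 + w ^ 2) - (ν * √2 * (z + w)) ^ 2 / (4 * -ν) = ν * z * w := by
    field_simp
    linear_combination 2 * (z + w) ^ 2 * hsqrt
  simp_rw [hkernel]
  rw [integral_const_mul, integral_cexp_quadratic (by simpa using hν), hroot, hexponent,
    ← mul_assoc, ← kappa_sq_mul_sqrt hν.le]
  norm_cast

theorem conj_bargmannKernel (ν : ℝ) (z : ℂ) (t : ℝ) :
    conj (bargmannKernel ν z t) = bargmannKernel ν (conj z) t :=
  map_bargmannKernel Complex.conjAe.toAlgHom Complex.continuous_conj z t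

section NormedSpace

variable {E : Type*} [NormedAddCommGroup E] [NormedSpace ℂ E]

/-- The coherent state at `w` in the direction `e`: pairing with it evaluates the component along
`e` of a Bargmann transform at `w`, see `inner_coherentState`. -/
def coherentState (ν : ℝ) (w : ℂ) (e : E) (t : ℝ) : E := bargmannKernel ν (conj w) t • e

theorem memLp_coherentState (hν : 0 < ν) (w : ℂ) (e : E) : MemLp (coherentState ν w e) 2 :=
  (ContinuousLinearMap.toSpanSingleton ℂ e).comp_memLp' (memLp_bargmannKernel hν (conj w))

theorem bargmann_coherentState [CompleteSpace E] (hν : 0 < ν) (w : ℂ) (e : E) (z : ℂ) :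
    bargmann ν (coherentState ν w e) z =
      ((ν / Real.pi : ℝ) * Complex.exp (ν * z * conj w)) • e := by
  rw [bargmann, ← integral_bargmannKernel_mul_bargmannKernel hν, ← integral_smul_const]
  simp only [coherentState, smul_smul]

end NormedSpace

variable {E : Type*} [NormedAddCommGroup E] [InnerProductSpace ℂ E] [CompleteSpace E]

theorem inner_coherentState (hν : 0 < ν) (w : ℂ) (e : E) (ψ : Lp E 2 (volume : Measure ℝ)) :
    ⟪(memLp_coherentState hν w e).toLp, ψ⟫_ℂ = ⟪e, bargmann ν ψ w⟫_ℂ := by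
  rw [L2.inner_def, bargmann, ← integral_inner (integrable_bargmannKernel_smul hν (Lp.memLp ψ) w)]
  refine integral_congr_ae ?_
  filter_upwards [(memLp_coherentState hν w e).coeFn_toLp] with t ht
  rw [ht, coherentState, inner_smul_left, inner_smul_right, conj_bargmannKernel,
    Complex.conj_conj]

theorem inner_weightedBargmann_coherentState (hν : 0 < ν) (w z : ℂ) (e v : E) :
    ⟪weightedBargmann ν (coherentState ν w e) z, Real.exp (-ν / 2 * ‖z‖ ^ 2) • v⟫_ℂ =
      (ν / Real.pi) • Real.exp (-ν * ‖z‖ ^ 2) • Complex.exp (ν * conj z * w) • ⟪e, v⟫_ℂ := by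
  have hweight : Real.exp (-ν * ‖z‖ ^ 2) = Real.exp (-ν / 2 * ‖z‖ ^ 2) ^ 2 := by
    rw [← Real.exp_nat_mul]
    ring_nf
  simp only [weightedBargmann, bargmann_coherentState hν, ← Complex.coe_smul, inner_smul_left,
    inner_smul_right, map_mul, Complex.conj_ofReal, ← Complex.exp_conj, Complex.conj_conj,
    smul_eq_mul, hweight]
  push_cast
  ring

theorem exists_bargmann_eq (hν : 0 < ν) {F : ℂ → E} (hF : Differentiable ℂ F)
    (hF2 : MemLp (fun z : ℂ => Real.exp (-ν / 2 * ‖z‖ ^ 2) • F z) 2) :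
    ∃ ψ : Lp E 2 (volume : Measure ℝ), bargmann ν ψ = F := by
  let B := (weightedBargmannL2 E hν).toContinuousLinearMap
  refine ⟨B.adjoint hF2.toLp, funext fun w => ext_inner_left ℂ fun e => ?_⟩
  let κ := (memLp_coherentState hν w e).toLp
  have hae : (fun z => ⟪B κ z, hF2.toLp _ z⟫_ℂ) =ᵐ[volume] fun z => (ν / Real.pi) •
      Real.exp (-ν * ‖z‖ ^ 2) • Complex.exp (ν * conj z * w) • ⟪e, F z⟫_ℂ := by
    have hBκ : B κ =ᵐ[volume] weightedBargmann ν κ := coeFn_weightedBargmannL2 hν κ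
    filter_upwards [hBκ, hF2.coeFn_toLp] with z hB hFz
    rw [hFz, ← inner_weightedBargmann_coherentState hν, hB, weightedBargmann,
      bargmann_congr (memLp_coherentState hν w e).coeFn_toLp, ← weightedBargmann]
  have hFe : Differentiable ℂ fun z => ⟪e, F z⟫_ℂ := (innerSL ℂ e).differentiable.comp hF
  have hc : ν / Real.pi ≠ 0 := (div_pos hν Real.pi_pos).ne'
  have hint := (integrable_smul_iff hc _).1 ((L2.integrable_inner (B κ) hF2.toLp).congr hae)
  rw [← inner_coherentState hν, ContinuousLinearMap.adjoint_inner_right, L2.inner_def,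
    integral_congr_ae hae, integral_smul, integral_gaussian_smul_exp_smul hν hFe w hint,
    ← inv_div ν, smul_inv_smul₀ hc]

end CoherentStates

section Fourier

variable {ν : ℝ}

theorem integrable_bargmannKernel (hν : 0 < ν) (z : ℂ) : Integrable (bargmannKernel ν z) := by
  have hquadratic := integrable_cexp_quadratic' (b := -ν / 2)
    (by norm_cast; linarith) (ν * √2 * z) (-ν / 2 * z ^ 2)
  refine (hquadratic.const_mul (kappa ν : ℂ)).congr (.of_forall fun t => ?_)
  simp only [bargmannKernel_complex]
  ring_nf

theorem integral_bargmannKernel_mul_exp (hν : 0 < ν) (z : ℂ) (y : ℝ) :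
    ∫ t : ℝ, bargmannKernel ν z t * Complex.exp (Complex.I * t * y) =
      √(2 * Real.pi / ν) * bargmannKernel ν (Complex.I * z) (y / ν) := by
  have hsqrt : ((√2 : ℝ) : ℂ) ^ 2 = 2 := by norm_cast; exact Real.sq_sqrt zero_le_two
  have hν' : (ν : ℂ) ≠ 0 := by exact_mod_cast hν.ne'
  have hkernel (t : ℝ) : bargmannKernel ν z t * Complex.exp (Complex.I * t * y) = kappa ν *
      Complex.exp (-ν / 2 * t ^ 2 + (ν * √2 * z + Complex.I * y) * t + -ν / 2 * z ^ 2) := by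
    rw [bargmannKernel_complex, mul_assoc, ← Complex.exp_add]
    ring_nf
  have hroot : ((Real.pi : ℂ) / -(-ν / 2)) ^ (1 / 2 : ℂ) = (√(2 * Real.pi / ν) : ℝ) := by
    rw [Real.sqrt_eq_rpow, Complex.ofReal_cpow (by positivity)]
    push_cast
    congr 1
    field_simp
  simp_rw [hkernel]
  rw [integral_const_mul, integral_cexp_quadratic (by norm_cast; linarith), hroot,
    bargmannKernel_complex, mul_left_comm]
  congr 3
  push_cast
  field_simp
  linear_combination 4 * ν ^ 2 * z ^ 2 * hsqrt + (4 * ν ^ 2 * z ^ 2 + 4 * y ^ 2) * Complex.I_sq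

section NormedSpace

variable {E : Type*} [NormedAddCommGroup E] [NormedSpace ℂ E] [CompleteSpace E]

theorem bargmann_angularFourier {ψ : ℝ → E} (hψ : Integrable ψ) (z : ℂ) :
    bargmann 1 (angularFourier ψ) z = √(2 * Real.pi) • bargmann 1 ψ (Complex.I * z) := by
  have hprod : Integrable (fun p : ℝ × ℝ =>
      bargmannKernel 1 z p.1 • Complex.exp (Complex.I * p.1 * p.2) • ψ p.2)
      (volume.prod volume) := by
    have hphase : Continuous fun p : ℝ × ℝ => Complex.exp (Complex.I * p.1 * p.2) := by fun_prop
    refine (((integrable_bargmannKernel one_pos z).smul_prod hψ).bdd_smul 1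
      hphase.aestronglyMeasurable (.of_forall fun p => ?_)).congr
      (.of_forall fun p => smul_comm _ _ _)
    rw [mul_assoc, ← Complex.ofReal_mul, Complex.norm_exp_I_mul_ofReal]
  simp only [bargmann, angularFourier, ← integral_smul]
  rw [integral_integral_swap hprod]
  refine integral_congr_ae (.of_forall fun y => ?_)
  simp only [smul_smul]
  rw [integral_smul_const, integral_bargmannKernel_mul_exp one_pos, mul_smul, Complex.coe_smul,
    div_one, div_one]

end NormedSpace

variable {E : Type*} [NormedAddCommGroup E] [InnerProductSpace ℂ E] [CompleteSpace E]

theorem bargmann_angularFourierL2 (ψ : Lp E 2 (volume : Measure ℝ)) (z : ℂ) :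
    bargmann 1 (angularFourierL2 E ψ) z = √(2 * Real.pi) • bargmann 1 ψ (Complex.I * z) := by
  have hcont (w : ℂ) (e : E) : Continuous fun φ : Lp E 2 (volume : Measure ℝ) =>
      inner ℂ e (bargmann 1 φ w) := by
    simp only [← inner_coherentState one_pos]
    fun_prop
  refine ext_inner_left ℂ fun e => ?_
  have hcont_rotated : Continuous fun φ : Lp E 2 (volume : Measure ℝ) =>
      inner ℂ e (√(2 * Real.pi) • bargmann 1 φ (Complex.I * z)) := by
    simpa only [inner_smul_right_eq_smul] using (hcont (Complex.I * z) e).fun_const_smul _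
  refine congrFun (((hcont z e).comp (angularFourierL2 E).continuous).ext_on
    (dense_integrable (by norm_num)) hcont_rotated fun φ hφ => ?_) ψ
  simp only [Function.comp_apply, bargmann_congr (coeFn_angularFourierL2 φ hφ),
    bargmann_angularFourier hφ]

end Fourier

section Naturality

theorem map_bargmann {𝔸 𝔹 E F : Type*} [NormedRing 𝔸] [NormedAlgebra ℝ 𝔸] [CompleteSpace 𝔸]
    [NormedRing 𝔹] [NormedAlgebra ℝ 𝔹] [NormedAddCommGroup E] [NormedSpace ℝ E] [Module 𝔹 E]
    [NormedAddCommGroup F] [NormedSpace ℝ F] [Module 𝔸 F] {ν : ℝ} {f : 𝔸 →ₐ[ℝ] 𝔹}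
    (hf : Continuous f) {L : E ≃L[ℝ] F} (hL : ∀ (a : 𝔸) (e : E), L (f a • e) = a • L e)
    (ψ : ℝ → E) (a : 𝔸) : L (bargmann ν ψ (f a)) = bargmann ν (L ∘ ψ) a := by
  simp only [bargmann, ← L.integral_comp_comm, ← map_bargmannKernel f hf, hL, Function.comp_apply]

/-- The equivalence of `Lp` spaces induced by an equivalence of the spaces of values. -/
def compLpEquiv {𝕜 α E F : Type*} [NontriviallyNormedField 𝕜] [MeasurableSpace α]
    [NormedAddCommGroup E] [NormedSpace 𝕜 E] [NormedAddCommGroup F] [NormedSpace 𝕜 F]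
    (p : ENNReal) [Fact (1 ≤ p)] (μ : Measure α) (L : E ≃L[𝕜] F) : Lp E p μ ≃L[𝕜] Lp F p μ :=
  .equivOfInverse ((L : E →L[𝕜] F).compLpL p μ) ((L.symm : F →L[𝕜] E).compLpL p μ)
    (fun ψ => Lp.ext <| by
      filter_upwards [(L.symm : F →L[𝕜] E).coeFn_compLpL ((L : E →L[𝕜] F).compLpL p μ ψ),
        (L : E →L[𝕜] F).coeFn_compLpL ψ] with t hsymm hL
      rw [hsymm, hL, ContinuousLinearEquiv.coe_coe, ContinuousLinearEquiv.coe_coe,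
        L.symm_apply_apply])
    (fun ψ => Lp.ext <| by
      filter_upwards [(L : E →L[𝕜] F).coeFn_compLpL ((L.symm : F →L[𝕜] E).compLpL p μ ψ),
        (L.symm : F →L[𝕜] E).coeFn_compLpL ψ] with t hL hsymm
      rw [hL, hsymm, ContinuousLinearEquiv.coe_coe, ContinuousLinearEquiv.coe_coe,
        L.apply_symm_apply])

theorem coeFn_compLpEquiv {𝕜 α E F : Type*} [NontriviallyNormedField 𝕜] [MeasurableSpace α]
    [NormedAddCommGroup E] [NormedSpace 𝕜 E] [NormedAddCommGroup F] [NormedSpace 𝕜 F]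
    {p : ENNReal} [Fact (1 ≤ p)] {μ : Measure α} (L : E ≃L[𝕜] F) (ψ : Lp E p μ) :
    compLpEquiv p μ L ψ =ᵐ[μ] L ∘ ψ :=
  (L : E →L[𝕜] F).coeFn_compLpL ψ

end Naturality

section SliceModule

variable {I : ℍ[ℝ]}

theorem mul_self_of_mem_imagUnits (hI : I ∈ imagUnits) : I * I = -1 := by rw [← sq]; exact hI

theorem norm_of_mem_imagUnits (hI : I ∈ imagUnits) : ‖I‖ = 1 := by
  rw [← pow_eq_one_iff_of_nonneg (norm_nonneg I) two_ne_zero, ← norm_pow, hI, norm_neg, norm_one]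

theorem re_of_mem_imagUnits (hI : I ∈ imagUnits) : I.re = 0 := by
  rw [← Quaternion.sq_eq_neg_normSq, Quaternion.normSq_eq_norm_mul_self, norm_of_mem_imagUnits hI,
    hI, mul_one, Quaternion.coe_one]

variable (I : imagUnits)

/-- The embedding of `ℂ` into `ℍ` whose image is the slice `ℂ_I`. -/
def sliceEmbed : ℂ →ₐ[ℝ] ℍ[ℝ] := Complex.lift ⟨I.1, mul_self_of_mem_imagUnits I.2⟩

theorem sliceEmbed_apply (z : ℂ) : sliceEmbed I z = slicePt I z.re z.im := by
  rw [slicePt, Quaternion.coe_mul_eq_smul]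
  exact Complex.liftAux_apply _ (mul_self_of_mem_imagUnits I.2) z

theorem sliceEmbed_I : sliceEmbed I Complex.I = I :=
  Complex.liftAux_apply_I _ (mul_self_of_mem_imagUnits I.2)

theorem sliceEmbed_ofReal (x : ℝ) : sliceEmbed I x = (x : ℍ[ℝ]) := (sliceEmbed I).commutes x

theorem norm_sliceEmbed (z : ℂ) : ‖sliceEmbed I z‖ = ‖z‖ := by
  have hI : Quaternion.normSq I.1 = 1 := by
    rw [Quaternion.normSq_eq_norm_mul_self, norm_of_mem_imagUnits I.2, one_mul]
  rw [← sq_eq_sq₀ (norm_nonneg _) (norm_nonneg _), sq, ← Quaternion.normSq_eq_norm_mul_self,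
    ← Complex.normSq_eq_norm_sq, Complex.normSq_apply, sliceEmbed_apply, slicePt,
    Quaternion.normSq_add, map_mul, hI]
  simp [Quaternion.normSq_coe, re_of_mem_imagUnits I.2, sq]

theorem continuous_sliceEmbed : Continuous (sliceEmbed I) :=
  (sliceEmbed I).toLinearMap.continuous_of_finiteDimensional

/-- The quaternions as a complex Hilbert space in which `i` acts as left multiplication by `I`. The
type synonym keeps this structure apart from the one of `ℍ`. -/
def SliceModule (_ : imagUnits) : Type := ℍ[ℝ]

instance : NormedAddCommGroup (SliceModule I) := inferInstanceAs (NormedAddCommGroup ℍ[ℝ])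

instance : CompleteSpace (SliceModule I) := inferInstanceAs (CompleteSpace ℍ[ℝ])

instance : Module ℂ (SliceModule I) := Module.compHom ℍ[ℝ] (sliceEmbed I).toRingHom

instance : NormedSpace ℂ (SliceModule I) where
  norm_smul_le z q := by
    rw [← norm_sliceEmbed I z]
    exact norm_mul_le (sliceEmbed I z) (q : ℍ[ℝ])

instance : InnerProductSpace ℂ (SliceModule I) :=
  .ofNorm ℂ fun x y => by
    simpa only [sq] using! parallelogram_law_with_norm ℝ (E := ℍ[ℝ]) x y

/-- The identity map from `ℍ` to `SliceModule I`. -/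
def toSlice : ℍ[ℝ] ≃ₗᵢ[ℝ] SliceModule I where
  toFun q := q
  invFun q := q
  map_add' _ _ := rfl
  map_smul' r q := by
    change r • q = sliceEmbed I (r : ℂ) * q
    rw [sliceEmbed_ofReal, Quaternion.coe_mul_eq_smul]
  left_inv _ := rfl
  right_inv _ := rfl
  norm_map' _ := rfl

theorem toSlice_sliceEmbed_mul (z : ℂ) (q : ℍ[ℝ]) :
    toSlice I (sliceEmbed I z * q) = z • toSlice I q := rfl

theorem toSlice_mul (q : ℍ[ℝ]) : toSlice I (I * q) = Complex.I • toSlice I q := by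
  rw [← toSlice_sliceEmbed_mul, sliceEmbed_I]

/-- The restriction of `f` to the slice `ℂ_I`, as a function of a complex variable. -/
def onSlice (f : ℍ[ℝ] → ℍ[ℝ]) (z : ℂ) : SliceModule I := toSlice I (f (sliceEmbed I z))

theorem onSlice_ofReal (f : ℍ[ℝ] → ℍ[ℝ]) (x : ℝ) : onSlice I f x = toSlice I (f x) := by
  rw [onSlice, sliceEmbed_ofReal]

theorem toSlice_symm_onSlice_mk (f : ℍ[ℝ] → ℍ[ℝ]) (x y : ℝ) :
    (toSlice I).symm (onSlice I f ⟨x, y⟩) = f (slicePt I x y) := by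
  rw [onSlice, LinearIsometryEquiv.symm_apply_apply, sliceEmbed_apply]

/-- The identification of `L²(ℝ; ℍ)` with the complex Hilbert space `L²(ℝ; SliceModule I)`. -/
def toSliceL2 : L2 ≃L[ℝ] Lp (SliceModule I) 2 (volume : Measure ℝ) :=
  compLpEquiv 2 volume (toSlice I).toContinuousLinearEquiv

theorem coeFn_toSliceL2 (ψ : L2) : toSliceL2 I ψ =ᵐ[volume] toSlice I ∘ ψ :=
  coeFn_compLpEquiv (toSlice I).toContinuousLinearEquiv ψ

theorem onSlice_segalBargmann (ν : ℝ) (ψ : L2) :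
    onSlice I (segalBargmann ν ψ) = bargmann ν (toSliceL2 I ψ) := by
  rw [bargmann_congr (coeFn_toSliceL2 I ψ)]
  exact funext <| map_bargmann (L := (toSlice I).toContinuousLinearEquiv) (continuous_sliceEmbed I)
    (toSlice_sliceEmbed_mul I) ψ

end SliceModule

section SliceRegular

theorem inv_norm_smul_mem_imagUnits {q : ℍ[ℝ]} (hre : q.re = 0) (hq : q ≠ 0) :
    ‖q‖⁻¹ • q ∈ imagUnits := by
  change _ ^ 2 = (-1 : ℍ[ℝ])
  rw [smul_pow, Quaternion.sq_eq_neg_normSq.2 hre, Quaternion.normSq_eq_norm_mul_self, smul_neg,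
    ← Quaternion.coe_smul, smul_eq_mul, ← sq, ← mul_pow, inv_mul_cancel₀ (norm_ne_zero_iff.2 hq),
    one_pow, Quaternion.coe_one]

theorem imagUnits_nonempty : imagUnits.Nonempty :=
  ⟨_, inv_norm_smul_mem_imagUnits (q := ⟨0, 1, 0, 0⟩) rfl fun h =>
    one_ne_zero (congrArg (fun q : ℍ[ℝ] => q.imI) h)⟩

theorem exists_sliceEmbed_eq (q : ℍ[ℝ]) : ∃ (I : imagUnits) (z : ℂ), sliceEmbed I z = q := by
  rcases eq_or_ne q.im 0 with him | him
  · obtain ⟨I, hI⟩ := imagUnits_nonempty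
    refine ⟨⟨I, hI⟩, q.re, ?_⟩
    rw [sliceEmbed_ofReal, ← add_zero (q.re : ℍ[ℝ]), ← him, q.re_add_im]
  · refine ⟨⟨_, inv_norm_smul_mem_imagUnits (Quaternion.re_im q) him⟩, ⟨q.re, ‖q.im‖⟩, ?_⟩
    rw [sliceEmbed_apply, slicePt, Quaternion.coe_mul_eq_smul,
      smul_inv_smul₀ (norm_ne_zero_iff.2 him), q.re_add_im]

variable {I : imagUnits} {f : ℍ[ℝ] → ℍ[ℝ]}

theorem contDiff_onSlice_iff {n : WithTop ℕ∞} : ContDiff ℝ n (onSlice I f) ↔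
    ContDiff ℝ n fun p : ℝ × ℝ => f (slicePt I p.1 p.2) := by
  rw [← Complex.equivRealProdCLM.symm.contDiff_comp_iff,
    ← (toSlice I).symm.toContinuousLinearEquiv.comp_contDiff_iff]
  exact iff_of_eq (congrArg _ (funext fun p => toSlice_symm_onSlice_mk I f p.1 p.2))

theorem hasDerivAt_slicePt_re {L : ℂ →L[ℝ] SliceModule I} {x y : ℝ}
    (h : HasFDerivAt (onSlice I f) L ⟨x, y⟩) :
    HasDerivAt (fun s => f (slicePt I s y)) ((toSlice I).symm (L 1)) x := by
  simp only [← toSlice_symm_onSlice_mk, Complex.mk_eq_add_mul_I] at h ⊢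
  have hline : HasDerivAt (fun s : ℝ => (s + y * Complex.I : ℂ)) 1 x :=
    Complex.ofRealCLM.hasDerivAt.add_const (y * Complex.I)
  exact (toSlice I).symm.toContinuousLinearEquiv.hasFDerivAt.comp_hasDerivAt x
    (HasFDerivAt.comp_hasDerivAt (l := onSlice I f) x h hline)

theorem hasDerivAt_slicePt_im {L : ℂ →L[ℝ] SliceModule I} {x y : ℝ}
    (h : HasFDerivAt (onSlice I f) L ⟨x, y⟩) :
    HasDerivAt (fun t => f (slicePt I x t)) ((toSlice I).symm (L Complex.I)) y := by
  simp only [← toSlice_symm_onSlice_mk, Complex.mk_eq_add_mul_I] at h ⊢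
  have hline : HasDerivAt (fun t : ℝ => (x + t * Complex.I : ℂ)) Complex.I y := by
    simpa using! (Complex.ofRealCLM.hasDerivAt.mul_const Complex.I).const_add (x : ℂ)
  exact (toSlice I).symm.toContinuousLinearEquiv.hasFDerivAt.comp_hasDerivAt y
    (HasFDerivAt.comp_hasDerivAt (l := onSlice I f) y h hline)

theorem dbar_eq_zero_iff_differentiableAt {x y : ℝ} (h : DifferentiableAt ℝ (onSlice I f) ⟨x, y⟩) :
    (1 / 2 : ℝ) • (deriv (fun s => f (slicePt I s y)) x +
      I * deriv (fun t => f (slicePt I x t)) y) = 0 ↔ DifferentiableAt ℂ (onSlice I f) ⟨x, y⟩ := by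
  rw [(hasDerivAt_slicePt_re h.hasFDerivAt).deriv, (hasDerivAt_slicePt_im h.hasFDerivAt).deriv,
    differentiableAt_complex_iff_differentiableAt_real, smul_eq_zero_iff_right (by norm_num),
    ← (toSlice I).map_eq_zero_iff, map_add, toSlice_mul, LinearIsometryEquiv.apply_symm_apply,
    LinearIsometryEquiv.apply_symm_apply, and_iff_right h,
    ← smul_eq_zero_iff_right Complex.I_ne_zero, smul_add, smul_smul, Complex.I_mul_I, neg_one_smul,
    ← sub_eq_add_neg, sub_eq_zero, eq_comm]

theorem isSliceRegular_iff : IsSliceRegular f ↔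
    Differentiable ℝ f ∧ ∀ I : imagUnits, Differentiable ℂ (onSlice I f) := by
  refine ⟨fun hf => ⟨hf.differentiable, fun I z => ?_⟩, fun ⟨hf, hslice⟩ => ⟨hf, ?_, ?_⟩⟩
  · have hreal : Differentiable ℝ (onSlice I f) :=
      (contDiff_onSlice_iff.2 (hf.contDiff_slice I I.2)).differentiable one_ne_zero
    exact (dbar_eq_zero_iff_differentiableAt (hreal z)).1 (hf.dbar_eq_zero I I.2 z.re z.im)
  · exact fun I hI => contDiff_onSlice_iff.1 ((hslice ⟨I, hI⟩).contDiff.restrict_scalars ℝ)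
  · exact fun I hI x y =>
      (dbar_eq_zero_iff_differentiableAt ((hslice ⟨I, hI⟩ ⟨x, y⟩).restrictScalars ℝ)).2
        (hslice ⟨I, hI⟩ ⟨x, y⟩)

theorem IsSliceRegular.ext_real {g : ℍ[ℝ] → ℍ[ℝ]} (hf : IsSliceRegular f) (hg : IsSliceRegular g)
    (h : ∀ x : ℝ, f x = g x) : f = g := by
  ext1 q
  obtain ⟨I, z, rfl⟩ := exists_sliceEmbed_eq q
  have hfreq : ∃ᶠ w in nhdsWithin (0 : ℂ) {0}ᶜ, onSlice I f w = onSlice I g w := by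
    have hreal : Filter.Tendsto ((↑) : ℝ → ℂ) (nhdsWithin 0 {0}ᶜ) (nhdsWithin (0 : ℝ) {0}ᶜ) :=
      Complex.continuous_ofReal.continuousWithinAt.tendsto_nhdsWithin fun x hx =>
        Complex.ofReal_injective.ne hx
    refine hreal.frequently (.of_forall fun x => ?_)
    rw [onSlice_ofReal, onSlice_ofReal, h]
  refine (toSlice I).injective (congrFun (AnalyticOnNhd.eq_of_frequently_eq
    (fun w _ => ?_) (fun w _ => ?_) hfreq) z)
  · exact ((isSliceRegular_iff.1 hf).2 I).analyticAt w
  · exact ((isSliceRegular_iff.1 hg).2 I).analyticAt w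

variable {ν : ℝ}

theorem differentiable_segalBargmann (hν : 0 < ν) (ψ : L2) :
    Differentiable ℝ (segalBargmann ν ψ) :=
  differentiable_bargmann (𝔸 := ℍ[ℝ]) ℝ hν (Lp.memLp ψ)

theorem isSliceRegular_segalBargmann (hν : 0 < ν) (ψ : L2) :
    IsSliceRegular (segalBargmann ν ψ) := by
  refine isSliceRegular_iff.2 ⟨differentiable_segalBargmann hν ψ, fun I => ?_⟩
  rw [onSlice_segalBargmann]
  exact differentiable_bargmann ℂ hν (Lp.memLp _)

theorem mem_fockSpace_iff {J : imagUnits} : f ∈ fockSpace ν J ↔ IsSliceRegular f ∧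
    MemLp (fun z : ℂ => Real.exp (-ν / 2 * ‖z‖ ^ 2) • onSlice J f z) 2 := by
  refine and_congr_right fun hf => ?_
  have hcont : Continuous fun z : ℂ => Real.exp (-ν / 2 * ‖z‖ ^ 2) • onSlice J f z :=
    .smul (f := fun z : ℂ => Real.exp (-ν / 2 * ‖z‖ ^ 2)) (by fun_prop)
      ((isSliceRegular_iff.1 hf).2 J).continuous
  rw [memLp_two_iff_integrable_sq_norm hcont.aestronglyMeasurable,
    ← Complex.volume_preserving_equiv_real_prod.symm.integrable_comp_emb
      Complex.measurableEquivRealProd.symm.measurableEmbedding]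
  refine integrable_congr (.of_forall fun p => ?_)
  simp only [Function.comp_apply, Complex.measurableEquivRealProd_symm_apply, onSlice, norm_smul,
    LinearIsometryEquiv.norm_map, ← norm_sliceEmbed J, sliceEmbed_apply, mul_pow, Real.norm_eq_abs,
    Real.abs_exp, ← Real.exp_nat_mul]
  rw [mul_comm]
  ring_nf

theorem bijOn_segalBargmann (hν : 0 < ν) (J : imagUnits) :
    Set.BijOn (segalBargmann ν) Set.univ (fockSpace ν J) := by
  refine ⟨fun ψ _ => ?_, fun ψ _ φ _ h => ?_, fun f hf => ?_⟩
  · refine mem_fockSpace_iff.2 ⟨isSliceRegular_segalBargmann hν ψ, ?_⟩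
    rw [onSlice_segalBargmann]
    exact memLp_weightedBargmann hν (Lp.memLp _)
  · refine (toSliceL2 J).injective (injective_bargmann hν ?_)
    simp only [← onSlice_segalBargmann, h]
  · obtain ⟨hreg, hmem⟩ := mem_fockSpace_iff.1 hf
    obtain ⟨ψ, hψ⟩ := exists_bargmann_eq hν ((isSliceRegular_iff.1 hreg).2 J) hmem
    refine ⟨(toSliceL2 J).symm ψ, Set.mem_univ _, ?_⟩
    refine (isSliceRegular_segalBargmann hν _).ext_real hreg fun x => (toSlice J).injective ?_
    rw [← onSlice_ofReal, ← onSlice_ofReal, onSlice_segalBargmann, (toSliceL2 J).apply_symm_apply,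
      hψ]

end SliceRegular

section SliceFourier

variable (I : imagUnits)

theorem toSlice_fourierIntegral (ψ : ℝ → ℍ[ℝ]) (x : ℝ) :
    toSlice I (fourierIntegral I ψ x) = angularFourier (toSlice I ∘ ψ) x := by
  have hexp (y : ℝ) : NormedSpace.exp (I * (x : ℍ[ℝ]) * (y : ℍ[ℝ])) =
      sliceEmbed I (Complex.exp (Complex.I * x * y)) := by
    rw [Complex.exp_eq_exp_ℂ, NormedSpace.map_exp (sliceEmbed I) (continuous_sliceEmbed I), map_mul,
      map_mul, sliceEmbed_I, sliceEmbed_ofReal, sliceEmbed_ofReal]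
  have hcomm := (toSlice I).toContinuousLinearEquiv.integral_comp_comm (μ := volume)
    fun y : ℝ => NormedSpace.exp (I * (x : ℍ[ℝ]) * (y : ℍ[ℝ])) * ψ y
  refine hcomm.symm.trans (integral_congr_ae (.of_forall fun y => ?_))
  simp only [hexp]
  exact toSlice_sliceEmbed_mul I _ _

/-- The Fourier transform with imaginary unit `I`, transported from the complex Hilbert space
`L²(ℝ; SliceModule I)`. -/
def sliceFourierL2 : L2 →L[ℝ] L2 :=
  (toSliceL2 I).symm ∘L ((angularFourierL2 (SliceModule I)).restrictScalars ℝ) ∘L toSliceL2 I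

theorem toSliceL2_sliceFourierL2 (ψ : L2) :
    toSliceL2 I (sliceFourierL2 I ψ) = angularFourierL2 (SliceModule I) (toSliceL2 I ψ) :=
  (toSliceL2 I).apply_symm_apply _

theorem isFourierExtension_sliceFourierL2 : IsFourierExtension I (sliceFourierL2 I) := by
  intro ψ hψ
  have hint : Integrable (toSliceL2 I ψ) :=
    ((toSlice I).toContinuousLinearEquiv.toContinuousLinearMap.integrable_comp hψ).congr
      (coeFn_toSliceL2 I ψ).symm
  filter_upwards [coeFn_toSliceL2 I (sliceFourierL2 I ψ), coeFn_angularFourierL2 _ hint]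
    with t htoSlice hfourier
  refine (toSlice I).injective ?_
  rw [toSlice_fourierIntegral, ← angularFourier_congr (coeFn_toSliceL2 I ψ), ← hfourier,
    ← toSliceL2_sliceFourierL2, htoSlice, Function.comp_apply]

theorem IsFourierExtension.unique {I : ℍ[ℝ]} {S T : L2 →L[ℝ] L2} (hS : IsFourierExtension I S)
    (hT : IsFourierExtension I T) : S = T :=
  ContinuousLinearMap.coeFn_injective <|
    S.continuous.ext_on (dense_integrable (p := 2) ENNReal.ofNat_ne_top) T.continuous fun ψ hψ =>
      Lp.ext ((hS ψ hψ).trans (hT ψ hψ).symm)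

theorem existsUnique_isFourierExtension : ∃! T : L2 →L[ℝ] L2, IsFourierExtension I T :=
  ⟨sliceFourierL2 I, isFourierExtension_sliceFourierL2 I,
    fun _ hT => hT.unique (isFourierExtension_sliceFourierL2 I)⟩

theorem fourierL2_eq_sliceFourierL2 : fourierL2 I = sliceFourierL2 I := by
  have hex := (existsUnique_isFourierExtension I).exists
  rw [fourierL2, dif_pos hex]
  exact hex.choose_spec.unique (isFourierExtension_sliceFourierL2 I)

theorem segalBargmann_fourierL2 (ψ : L2) (z : ℂ) :
    segalBargmann 1 (fourierL2 I ψ) (sliceEmbed I z) =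
      √(2 * Real.pi) • segalBargmann 1 ψ (I * sliceEmbed I z) := by
  refine (toSlice I).injective ?_
  have h := bargmann_angularFourierL2 (toSliceL2 I ψ) z
  rw [← toSliceL2_sliceFourierL2, ← onSlice_segalBargmann, ← onSlice_segalBargmann,
    ← fourierL2_eq_sliceFourierL2, onSlice, onSlice, map_mul, sliceEmbed_I] at h
  rw [h, map_smul]

theorem segalBargmann_segalBargmannInv {ν : ℝ} (hν : 0 < ν) {J : imagUnits} {f : ℍ[ℝ] → ℍ[ℝ]}
    (hf : f ∈ fockSpace ν J) : segalBargmann ν (segalBargmannInv ν f) = f := by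
  obtain ⟨ψ, -, hψ⟩ := (bijOn_segalBargmann hν J).surjOn hf
  exact Function.invFun_eq ⟨ψ, hψ⟩

end SliceFourier

end SliceFock

end

theorem mainTheorem4_general (I J : ℍ[ℝ]) (hI : I ∈ SliceFock.imagUnits)
    (hJ : J ∈ SliceFock.imagUnits) :
    (∀ ν > 0, Set.BijOn (SliceFock.segalBargmann ν) Set.univ (SliceFock.fockSpace ν J)) ∧
    (∃! T : SliceFock.L2 →L[ℝ] SliceFock.L2, SliceFock.IsFourierExtension I T) ∧
    ∀ f ∈ SliceFock.fockSpace 1 J, ∀ x y : ℝ,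
      SliceFock.segalBargmann 1 (SliceFock.fourierL2 I (SliceFock.segalBargmannInv 1 f))
          (SliceFock.slicePt I x y)
        = Real.sqrt (2 * Real.pi) • f (I * SliceFock.slicePt I x y) := by
  refine ⟨fun ν hν => SliceFock.bijOn_segalBargmann hν ⟨J, hJ⟩,
    SliceFock.existsUnique_isFourierExtension ⟨I, hI⟩, fun f hf x y => ?_⟩
  have hfourier := SliceFock.segalBargmann_fourierL2 ⟨I, hI⟩ (SliceFock.segalBargmannInv 1 f) ⟨x, y⟩
  rwa [SliceFock.segalBargmann_segalBargmannInv one_pos (J := ⟨J, hJ⟩) hf,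
    SliceFock.sliceEmbed_apply] at hfourier

theorem mainTheorem4 (I J : ℍ[ℝ]) (hI : I ∈ SliceFock.imagUnits) (hJ : J ∈ SliceFock.imagUnits) :
    Set.BijOn (SliceFock.segalBargmann 1) Set.univ (SliceFock.fockSpace 1 J) ∧
    (∃! T : SliceFock.L2 →L[ℝ] SliceFock.L2, SliceFock.IsFourierExtension I T) ∧
    ∀ f ∈ SliceFock.fockSpace 1 J, ∀ x : ℝ,
      SliceFock.segalBargmann 1 (SliceFock.fourierL2 I (SliceFock.segalBargmannInv 1 f)) (x : ℍ[ℝ])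
        = Real.sqrt (2 * Real.pi) • f (I * (x : ℍ[ℝ])) := by
  obtain ⟨hbij, hext, hconj⟩ := mainTheorem4_general I J hI hJ
  exact ⟨hbij 1 one_pos, hext, fun f hf x => by simpa [SliceFock.slicePt] using hconj f hf x 0⟩
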